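/- Let $G$ be a finite simple graph with vertex set $V$, $|V|\ge 1$ (not necessarily connected), let $A=(a_{ij})$ be its adjacency matrix and let $\lambda_1(G)$ be the largest eigenvalue of $A$. For $\alpha,\beta\in\mathbb{R}$ let $\xi(t)$ be the (minimal) continuous-time Markov chain on $\mathbb{Z}_+^V$ (where $\mathbb{Z}_+=\{0,1,2,\dots\}$) in which, given $\xi(t)=\xi$, the component $\xi_i$ increases by $1$ at rate $e^{\alpha\xi_i+\beta\sum_{j\sim i}\xi_j}$ and, if $\xi_i>0$, decreases by $1$ at rate $1$, for each $i\in V$. If $\alpha<0$ and $\alpha+\beta\lambda_1(G)=0$, then 1. $\xi(t)$ is transient: for every state $\xi$, the chain started at $\xi$ a.s. has a bounded set $\{t\ge0:\xi(t)=\xi\}$ of times spent at $\xi$; and 2. $\xi(t)$ is non-explosive: from every initial state, the explosion time (the sum of all the holding times) is a.s. infinite. -/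

import Mathlib

open MeasureTheory ProbabilityTheory
open scoped NNReal ENNReal

noncomputable section

namespace InteractingWalks

/-! ### Continuous-time Markov chains on a countable state space -/

/-- The transition rates `q_{x,y}` of a continuous-time Markov chain on `S`: they are
non-negative, vanish on the diagonal, and the total rate `q_x = ∑_y q_{x,y}` of leaving
any state `x` is finite and positive (no instantaneous and no absorbing states). -/
structure JumpRates (S : Type*) where
  /-- the rate of jumping from the first to the second state -/
  rate : S → S → ℝ≥0
  rate_self : ∀ x, rate x x = 0
  summable : ∀ x, Summable (rate x)
  exit_pos : ∀ x, 0 < ∑' y, rate x y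

namespace JumpRates

variable {S : Type*} (q : JumpRates S)

/-- The total rate `q_x = ∑_y q_{x,y}` of leaving the state `x`. -/
def exitRate (x : S) : ℝ≥0 := ∑' y, q.rate x y

/-- The law `p_{x,y} = q_{x,y} / q_x` of the next state after `x`. -/
def jumpPMF (x : S) : PMF S :=
  ⟨fun y => ((q.rate x y / q.exitRate x : ℝ≥0) : ℝ≥0∞), by
    have h : HasSum (fun y => q.rate x y / q.exitRate x) 1 := by
      have h1 := (q.summable x).hasSum.div_const (q.exitRate x)
      have h2 : (∑' y, q.rate x y) / q.exitRate x = 1 := div_self (q.exit_pos x).ne'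
      rwa [h2] at h1
    exact ENNReal.coe_one ▸ ENNReal.hasSum_coe.2 h⟩

/-- The holding time `E_n / q_{Y_n}` in the state `Y_n`; given the embedded chain these are
independent and exponential of rate `q_{Y_n}`. -/
def holdingTime (n : ℕ) (ω : (ℕ → S) × (ℕ → ℝ)) : ℝ := ω.2 n / q.exitRate (ω.1 n)

/-- The time of the `n`-th jump (time `0` for `n = 0`). -/
def jumpTime (n : ℕ) (ω : (ℕ → S) × (ℕ → ℝ)) : ℝ := ∑ k ∈ Finset.range n, q.holdingTime k ω

/-- The explosion time: the sum of all the holding times, possibly infinite. -/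
def explosionTime (ω : (ℕ → S) × (ℕ → ℝ)) : ℝ≥0∞ := ∑' n, ENNReal.ofReal (q.holdingTime n ω)

open Classical in
/-- The (minimal, right-continuous) continuous-time Markov chain with jump rates `q`: it is in the
state `Y_n` from the `n`-th jump time until the next one, and in the cemetery state `none` from the
explosion time on. -/
def process (t : ℝ≥0) (ω : (ℕ → S) × (ℕ → ℝ)) : Option S :=
  if h : ∃ n, q.jumpTime n ω ≤ t ∧ (t : ℝ) < q.jumpTime (n + 1) ω then some (ω.1 (Nat.find h))
  else none

variable [Countable S] [MeasurableSpace S] [DiscreteMeasurableSpace S]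

/-- The transition kernel of the embedded discrete-time chain. -/
def jumpKernel : Kernel S S where
  toFun x := (q.jumpPMF x).toMeasure
  measurable' := measurable_of_countable _

instance : IsMarkovKernel q.jumpKernel :=
  ⟨fun x => PMF.toMeasure.isProbabilityMeasure (q.jumpPMF x)⟩

/-- The law on `ℕ → S` of the embedded discrete-time Markov chain started at `x`: the first state
is `x`, and given the history up to time `n` the next state is drawn from the transition kernel
at the present state. -/
def jumpChainLaw (x : S) : Measure (ℕ → S) :=
  Kernel.trajMeasure (X := fun _ => S) (Measure.dirac x) fun n =>
    q.jumpKernel.comap (fun h : (i : Finset.Iic n) → S => h ⟨n, Finset.mem_Iic.2 le_rfl⟩)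
      (measurable_pi_apply _)

instance : IsProbabilityMeasure (expMeasure 1) :=
  isProbabilityMeasure_expMeasure one_pos

/-- The law of an independent sequence of exponential variables of rate one. -/
def clockLaw : Measure (ℕ → ℝ) := Measure.infinitePi fun _ => expMeasure 1

/-- The probability space that carries the continuous-time chain started at `x`: an embedded chain
`(Y_n)` started at `x` and, independently of it, independent standard exponential clocks
`(E_n)`. -/
def law (x : S) : Measure ((ℕ → S) × (ℕ → ℝ)) := (q.jumpChainLaw x).prod clockLaw

/-- The chain is transient: for every state `x`, the chain started at `x` a.s. is at `x` only during
a bounded set of times. -/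
def IsTransient : Prop :=
  ∀ x : S, ∀ᵐ ω ∂q.law x, BddAbove {t : ℝ≥0 | q.process t ω = some x}

/-- The chain is non-explosive: from every initial state, the explosion time is a.s. infinite. -/
def IsNonExplosive : Prop :=
  ∀ x : S, ∀ᵐ ω ∂q.law x, q.explosionTime ω = ∞

end JumpRates

/-! ### The system of interacting random walks on a finite graph -/

variable {V : Type*} [Fintype V] [DecidableEq V] (G : SimpleGraph V) [DecidableRel G.Adj]

/-- The rate of jumping from `ξ` to `η`: it is `exp (α ξ_i + β ∑_{j ∼ i} ξ_j)` if `η = ξ + e_i`, it is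
`1` if `η = ξ - e_i`, and it is `0` in all other cases. (At most one of the summands is non-zero.) -/
def walkRate (α β : ℝ) (ξ η : V → ℕ) : ℝ≥0 :=
  (∑ i, if η = ξ + Pi.single i 1 then
      (Real.exp (α * ξ i + β * ∑ j ∈ G.neighborFinset i, (ξ j : ℝ))).toNNReal else 0) +
    ∑ i, if η + Pi.single i 1 = ξ then 1 else 0

theorem walkRate_summable (α β : ℝ) (ξ : V → ℕ) : Summable (walkRate G α β ξ) := by
  refine Summable.add (summable_sum fun i _ => ?_) (summable_sum fun i _ => ?_)
  · exact (hasSum_ite_eq (ξ + Pi.single i 1) _).summable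
  · refine summable_of_hasFiniteSupport (Set.Subsingleton.finite ?_)
    intro η hη η' hη'
    have h1 : η + Pi.single i 1 = ξ := by by_contra h; simp [h] at hη
    have h2 : η' + Pi.single i 1 = ξ := by by_contra h; simp [h] at hη'
    exact add_right_cancel (h1.trans h2.symm)

theorem walkRate_exit_pos [Nonempty V] (α β : ℝ) (ξ : V → ℕ) :
    0 < ∑' η, walkRate G α β ξ η := by
  obtain ⟨i⟩ := ‹Nonempty V›
  have h : 0 < walkRate G α β ξ (ξ + Pi.single i 1) := by
    unfold walkRate
    refine add_pos_of_pos_of_nonneg ?_ (zero_le)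
    refine Finset.sum_pos' (fun _ _ => zero_le) ⟨i, Finset.mem_univ i, ?_⟩
    rw [if_pos rfl]
    exact Real.toNNReal_pos.2 (Real.exp_pos _)
  exact h.trans_le ((walkRate_summable G α β ξ).le_tsum _ fun _ _ => zero_le)

/-- The jump rates of the system of interacting random walks. -/
def walk [Nonempty V] (α β : ℝ) : JumpRates (V → ℕ) where
  rate := walkRate G α β
  rate_self ξ := by simp [walkRate]
  summable ξ := walkRate_summable G α β ξ
  exit_pos ξ := walkRate_exit_pos G α β ξ

/-- The largest eigenvalue `λ₁(G)` of the adjacency matrix of `G`. -/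
def lambdaOne [Nonempty V] : ℝ :=
  (G.isHermitian_adjMatrix ℝ).eigenvalues₀ ⟨0, Fintype.card_pos⟩

end InteractingWalks

end

/-! Write `B = α I + β A` (`interaction`). Criticality forces `β > 0`, so the top eigenvalue of `B`
is `0`: `B` is negative semidefinite and, by the Perron argument of replacing an eigenvector by its
absolute value, kills a probability vector `v`.

Transience: the chain is reversible for `exp (logWeight)`, where `logWeight ξ = ξᵀBξ/2 - (α/2) ∑
ξ_j`. Along a lattice path at bounded distance from the ray through `v` the quadratic part stays
bounded, while the linear part grows because `α < 0`. Conductances thus grow geometrically and the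
path has finite resistance. Comparing the Dirichlet energy of the truncated Green function with its
drop along the path bounds the expected number of visits (`visits_le_of_path`), and Borel–Cantelli
concludes.

Non-explosion: `f = 1 + ∑ ξ_j - ξᵀBξ/2` has finite sublevel sets, and its drift is bounded above,
since a coordinate with `b = (Bξ)_i` contributes about `-b e^b` when `b` is large (`drift_bound`). A
discounted supermartingale then shows that the mean holding times along the embedded chain are not
summable, and a Laplace transform estimate carries this over to the exponential clocks. -/

open Filter Topology

/-! ### The embedded chain, its Markov property, and sums of exponential clocks. -/

namespace InteractingWalks

namespace JumpRates

variable {S : Type*} (q : JumpRates S)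

theorem exitRate_pos (x : S) : 0 < q.exitRate x := q.exit_pos x

theorem jumpPMF_apply (x y : S) : q.jumpPMF x y = q.rate x y / q.exitRate x :=
  ENNReal.coe_div (q.exitRate_pos x).ne'

theorem coe_exitRate (x : S) : (q.exitRate x : ℝ≥0∞) = ∑' y, (q.rate x y : ℝ≥0∞) :=
  ENNReal.coe_tsum (q.summable x)

/-- The expectation of `φ` at the next state after `x`. -/
noncomputable def step (φ : S → ℝ≥0∞) (x : S) : ℝ≥0∞ := ∑' y, q.jumpPMF x y * φ y

theorem exitRate_mul_step (φ : S → ℝ≥0∞) (x : S) :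
    q.exitRate x * q.step φ x = ∑' y, (q.rate x y : ℝ≥0∞) * φ y := by
  have h0 : (q.exitRate x : ℝ≥0∞) ≠ 0 := by exact_mod_cast (q.exitRate_pos x).ne'
  rw [step, ← ENNReal.tsum_mul_left]
  refine tsum_congr fun y => ?_
  rw [jumpPMF_apply, ← mul_assoc, ENNReal.mul_div_cancel h0 ENNReal.coe_ne_top]

variable [Countable S] [MeasurableSpace S] [DiscreteMeasurableSpace S]

theorem lintegral_jumpKernel (φ : S → ℝ≥0∞) (x : S) :
    ∫⁻ y, φ y ∂q.jumpKernel x = q.step φ x := by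
  change ∫⁻ y, φ y ∂(q.jumpPMF x).toMeasure = _
  rw [lintegral_countable']
  refine tsum_congr fun y => ?_
  rw [PMF.toMeasure_apply_singleton _ _ (measurableSet_singleton y), mul_comm]

instance (x : S) : IsProbabilityMeasure (q.jumpChainLaw x) := by
  unfold jumpChainLaw; infer_instance

/-- The Markov property of the embedded chain. -/
theorem lintegral_jumpChainLaw_succ (x : S) (n : ℕ) {H : ((i : Finset.Iic n) → S) → ℝ≥0∞}
    (hH : Measurable H) (φ : S → ℝ≥0∞) :
    ∫⁻ ω, H (Preorder.frestrictLe n ω) * φ (ω (n + 1)) ∂q.jumpChainLaw x =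
      ∫⁻ ω, H (Preorder.frestrictLe n ω) * q.step φ (ω n) ∂q.jumpChainLaw x := by
  have hφ : Measurable φ := measurable_of_countable _
  have key := Kernel.map_frestrictLe_trajMeasure_compProd_eq_map_trajMeasure
    (X := fun _ => S) (μ₀ := Measure.dirac x) (κ := fun n =>
      q.jumpKernel.comap (fun h : (i : Finset.Iic n) → S => h ⟨n, Finset.mem_Iic.2 le_rfl⟩)
        (measurable_pi_apply _)) (a := n)
  have h1 := congrArg (fun μ => ∫⁻ p, H p.1 * φ p.2 ∂μ) key
  rw [Measure.lintegral_compProd (by fun_prop), lintegral_map (by fun_prop) (by fun_prop),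
    lintegral_map (by fun_prop) (by fun_prop)] at h1
  refine h1.symm.trans (lintegral_congr fun ω => ?_)
  dsimp only
  rw [Kernel.comap_apply, lintegral_const_mul _ hφ, lintegral_jumpKernel]
  rfl

theorem ae_jumpChainLaw_zero (x : S) : ∀ᵐ ω ∂q.jumpChainLaw x, ω 0 = x := by
  have h : (q.jumpChainLaw x).map (fun ω => ω 0) = Measure.dirac x := by
    have h2 := Kernel.traj_map_frestrictLe (X := fun _ => S) (κ := fun n =>
      q.jumpKernel.comap (fun h : (i : Finset.Iic n) → S => h ⟨n, Finset.mem_Iic.2 le_rfl⟩)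
        (measurable_pi_apply _)) 0 0
    rw [Kernel.partialTraj_self] at h2
    have h3 : (q.jumpChainLaw x).map (Preorder.frestrictLe 0) =
        (Measure.dirac x).map (MeasurableEquiv.piUnique fun _ : Finset.Iic 0 => S).symm := by
      rw [jumpChainLaw, Kernel.trajMeasure, Measure.map_comp _ _ (by fun_prop), h2,
        Measure.id_comp]
    have h4 := congrArg (fun μ => μ.map
      (fun h : (i : Finset.Iic 0) → S => h ⟨0, Finset.mem_Iic.2 le_rfl⟩)) h3
    rw [Measure.map_map (by fun_prop) (by fun_prop),
      Measure.map_map (by fun_prop) (by fun_prop), Measure.map_dirac' (by fun_prop)] at h4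
    exact h4
  have : ∀ᵐ y ∂(q.jumpChainLaw x).map (fun ω => ω 0), y = x := by
    rw [h, ae_dirac_iff (MeasurableSet.of_discrete)]
  exact ae_of_ae_map (measurable_pi_apply 0).aemeasurable this

/-- The induction peels off the last step, replacing `φ` by `q.step φ`; hence `φ` is generalized. -/
theorem lintegral_jumpChainLaw_apply (x : S) (n : ℕ) (φ : S → ℝ≥0∞) :
    ∫⁻ ω, φ (ω n) ∂q.jumpChainLaw x = (q.step^[n] φ) x := by
  induction n generalizing φ with
  | zero =>
    rw [lintegral_congr_ae (g := fun _ => φ x)]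
    · simp
    · filter_upwards [q.ae_jumpChainLaw_zero x] with ω hω
      rw [hω]
  | succ n ih =>
    have h := q.lintegral_jumpChainLaw_succ x n (H := fun _ => 1) measurable_const φ
    simp only [one_mul] at h
    rw [h, ih, Function.iterate_succ_apply]

/-! ### Divergence of weighted sums of exponential variables -/

instance : IsProbabilityMeasure clockLaw := by unfold clockLaw; infer_instance

/-- Tilting the rate `1` density by `exp (-a x)` gives `1 / (1 + a)` times the density of rate `1 +
a`. -/
theorem lintegral_exp_neg_expMeasure {a : ℝ} (ha : 0 ≤ a) :
    ∫⁻ x, ENNReal.ofReal (Real.exp (-(a * x))) ∂expMeasure 1 = ENNReal.ofReal (1 / (1 + a)) := by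
  have h1 : ∀ x, exponentialPDF 1 x * ENNReal.ofReal (Real.exp (-(a * x))) =
      ENNReal.ofReal (1 / (1 + a)) * exponentialPDF (1 + a) x := by
    intro x
    rw [exponentialPDF_eq, exponentialPDF_eq, ← ENNReal.ofReal_mul (by split_ifs <;> positivity),
      ← ENNReal.ofReal_mul (by positivity)]
    split_ifs
    · congr 1
      rw [mul_assoc, ← Real.exp_add]
      field_simp
      ring_nf
    · simp
  rw [expMeasure, gammaMeasure]
  change ∫⁻ x, _ ∂(volume.withDensity (exponentialPDF 1)) = _
  have hm : Measurable (exponentialPDF 1) := (measurable_exponentialPDFReal 1).ennreal_ofReal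
  rw [lintegral_withDensity_eq_lintegral_mul _ hm (by fun_prop)]
  simp only [Pi.mul_apply, h1]
  rw [lintegral_const_mul _ (show Measurable (exponentialPDF (1 + a)) from
      (measurable_exponentialPDFReal _).ennreal_ofReal),
    lintegral_exponentialPDF_eq_one (by linarith), mul_one]

theorem one_add_sum_range_le_prod {a : ℕ → ℝ} (ha : ∀ n, 0 ≤ a n) (n : ℕ) :
    1 + ∑ k ∈ Finset.range n, a k ≤ ∏ k ∈ Finset.range n, (1 + a k) := by
  induction n with
  | zero => simp
  | succ n ih =>
    rw [Finset.sum_range_succ, Finset.prod_range_succ]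
    nlinarith [mul_nonneg (Finset.sum_nonneg fun k (_ : k ∈ Finset.range n) => ha k) (ha n),
      mul_le_mul_of_nonneg_right ih (add_nonneg zero_le_one (ha n))]

/-- By independence the Laplace transform of a partial sum is `∏ 1 / (1 + a k) ≤ 1 / (1 + ∑ a k)`,
which tends to `0`; so `exp (-sum)` vanishes almost surely. -/
theorem tsum_clock_eq_top {a : ℕ → ℝ} (ha : ∀ n, 0 ≤ a n) (hs : ¬ Summable a) :
    ∀ᵐ e ∂clockLaw, ∑' n, ENNReal.ofReal (a n * e n) = ∞ := by
  set X : ℕ → (ℕ → ℝ) → ℝ≥0∞ := fun n e => ENNReal.ofReal (Real.exp (-(a n * e n))) with hX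
  have hXm : ∀ n, Measurable (X n) := fun n => by fun_prop
  have hind : iIndepFun X clockLaw :=
    iIndepFun_infinitePi (X := fun n x => ENNReal.ofReal (Real.exp (-(a n * x))))
      (fun n => by fun_prop)
  have hint : ∀ n, ∫⁻ e, X n e ∂clockLaw = ENNReal.ofReal (1 / (1 + a n)) := by
    intro n
    rw [← lintegral_exp_neg_expMeasure (ha n),
      ← Measure.infinitePi_map_eval (fun _ : ℕ => expMeasure 1) n,
      lintegral_map (by fun_prop) (by fun_prop)]
    rfl
  -- `F` plays the role of `exp (-∑ a n * e n)`; the infimum makes sense even where some clock value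
  -- is negative.
  set F : (ℕ → ℝ) → ℝ≥0∞ := fun e => ⨅ n, ∏ k ∈ Finset.range n, X k e with hF
  have hFm : Measurable F :=
    Measurable.iInf fun n => Finset.measurable_fun_prod _ fun k _ => hXm k
  have hle : ∀ n, ∫⁻ e, F e ∂clockLaw ≤ ENNReal.ofReal (1 / (1 + ∑ k ∈ Finset.range n, a k)) := by
    intro n
    calc ∫⁻ e, F e ∂clockLaw ≤ ∫⁻ e, ∏ k ∈ Finset.range n, X k e ∂clockLaw :=
          lintegral_mono fun e => iInf_le _ n
      _ = ENNReal.ofReal (∏ k ∈ Finset.range n, (1 / (1 + a k))) := by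
          rw [lintegral_prod_eq_prod_lintegral_of_indepFun _ _ hind hXm,
            ENNReal.ofReal_prod_of_nonneg
              fun k _ => div_nonneg zero_le_one (add_nonneg zero_le_one (ha k))]
          exact Finset.prod_congr rfl fun k _ => hint k
      _ ≤ _ := by
          refine ENNReal.ofReal_le_ofReal ?_
          rw [Finset.prod_div_distrib, Finset.prod_const_one]
          refine one_div_le_one_div_of_le
            (add_pos_of_pos_of_nonneg one_pos (Finset.sum_nonneg fun k _ => ha k)) ?_
          exact one_add_sum_range_le_prod ha n
  have hF0 : ∫⁻ e, F e ∂clockLaw = 0 := by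
    have ht : Tendsto (fun n => ∑ k ∈ Finset.range n, a k) atTop atTop :=
      (not_summable_iff_tendsto_nat_atTop_of_nonneg ha).1 hs
    have ht2 : Tendsto (fun n => ENNReal.ofReal (1 / (1 + ∑ k ∈ Finset.range n, a k)))
        atTop (𝓝 0) := by
      rw [← ENNReal.ofReal_zero]
      refine ENNReal.tendsto_ofReal ?_
      simp only [one_div]
      exact (tendsto_atTop_add_const_left _ _ ht).inv_tendsto_atTop
    exact le_antisymm (ge_of_tendsto' ht2 hle) zero_le
  filter_upwards [(lintegral_eq_zero_iff hFm).1 hF0] with e he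
  by_contra hfin
  set K := ∑' n, ENNReal.ofReal (a n * e n) with hK
  have hpos : ENNReal.ofReal (Real.exp (-K.toReal)) ≤ F e := by
    refine le_iInf fun n => ?_
    rw [hX, ← ENNReal.ofReal_prod_of_nonneg fun k _ => (Real.exp_pos _).le, ← Real.exp_sum]
    refine ENNReal.ofReal_le_ofReal (Real.exp_le_exp.2 ?_)
    rw [Finset.sum_neg_distrib, neg_le_neg_iff]
    have h1 : ∑ k ∈ Finset.range n, ENNReal.ofReal (a k * e k) ≤ K := ENNReal.sum_le_tsum _
    calc ∑ k ∈ Finset.range n, a k * e k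
        ≤ ∑ k ∈ Finset.range n, (ENNReal.ofReal (a k * e k)).toReal :=
          Finset.sum_le_sum fun k _ => by
            rw [ENNReal.toReal_ofReal']; exact le_max_left _ _
      _ = (∑ k ∈ Finset.range n, ENNReal.ofReal (a k * e k)).toReal :=
          (ENNReal.toReal_sum fun k _ => ENNReal.ofReal_ne_top).symm
      _ ≤ K.toReal := ENNReal.toReal_mono hfin h1
  rw [Pi.zero_apply] at he
  rw [he, nonpos_iff_eq_zero, ENNReal.ofReal_eq_zero] at hpos
  exact absurd (Real.exp_pos _) (not_lt.2 hpos)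

end JumpRates
end InteractingWalks

namespace InteractingWalks

namespace JumpRates

variable {S : Type*} (q : JumpRates S)

section
variable [Countable S] [MeasurableSpace S] [DiscreteMeasurableSpace S]

/-! ### A Lyapunov criterion for non-explosion -/

/-- If `f` grows at most exponentially in the mean, then its expectation, discounted by
`q_y / (q_y + C)` at every visit to a state `y`, does not grow. -/
theorem lintegral_discounted_le {f : S → ℝ≥0} {C : ℝ≥0}
    (hf : ∀ y, ∑' z, (q.rate y z : ℝ≥0∞) * f z ≤ (q.exitRate y + C) * f y) (x : S) (n : ℕ) :
    ∫⁻ ω, (∏ k ∈ Finset.range n, ((q.exitRate (ω k) / (q.exitRate (ω k) + C) : ℝ≥0) : ℝ≥0∞)) *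
      f (ω n) ∂q.jumpChainLaw x ≤ f x := by
  set w : S → ℝ≥0∞ := fun y => ((q.exitRate y / (q.exitRate y + C) : ℝ≥0) : ℝ≥0∞) with hw
  -- The one-step supermartingale inequality, a rescaling of `hf`.
  have hwf : ∀ y, w y * q.step (fun z => f z) y ≤ f y := by
    intro y
    have hq : q.exitRate y + C ≠ 0 := (add_pos_of_pos_of_nonneg (q.exitRate_pos y) zero_le).ne'
    have hq' : ((q.exitRate y + C : ℝ≥0) : ℝ≥0∞) ≠ 0 := by exact_mod_cast hq
    have h1 : w y = (q.exitRate y : ℝ≥0∞) / ((q.exitRate y + C : ℝ≥0) : ℝ≥0∞) :=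
      ENNReal.coe_div hq
    rw [h1, ENNReal.div_eq_inv_mul, mul_assoc, q.exitRate_mul_step,
      ENNReal.inv_mul_le_iff hq' ENNReal.coe_ne_top, ENNReal.coe_add]
    exact hf y
  induction n with
  | zero =>
    simp only [Finset.range_zero, Finset.prod_empty, one_mul]
    rw [q.lintegral_jumpChainLaw_apply x 0 (fun y => f y)]
    rfl
  | succ n ih =>
    refine le_trans ?_ ih
    have hH : Measurable fun h : (i : Finset.Iic n) → S => ∏ i : Finset.Iic n, w (h i) :=
      Finset.measurable_fun_prod _ fun i _ =>
        (measurable_of_countable w).comp (measurable_pi_apply i)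
    have hprod : ∀ ω : ℕ → S, ∏ i : Finset.Iic n, w (Preorder.frestrictLe n ω i) =
        ∏ k ∈ Finset.range (n + 1), w (ω k) := by
      intro ω
      have hI : Finset.Iic n = Finset.range (n + 1) := by ext; simp
      rw [← hI]
      exact Finset.prod_coe_sort (Finset.Iic n) fun k => w (ω k)
    have h := q.lintegral_jumpChainLaw_succ x n hH (fun z => f z)
    simp only [hprod] at h
    rw [h]
    refine lintegral_mono fun ω => ?_
    dsimp only
    rw [Finset.prod_range_succ, mul_assoc]
    gcongr
    exact hwf (ω n)

/-- By Fatou the discounted values of `f` have a finite lower limit. Were the inverse rates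
summable, the discount would stay away from `0`, so `f` would be bounded infinitely often. The chain
would then return infinitely often to a finite set, where the rates are bounded, although `1 / q`
tends to `0`. -/
theorem not_summable_inv_exitRate {f : S → ℝ≥0} {C : ℝ≥0}
    (hfin : ∀ R : ℝ≥0, {y | f y ≤ R}.Finite)
    (hf : ∀ y, ∑' z, (q.rate y z : ℝ≥0∞) * f z ≤ (q.exitRate y + C) * f y) (x : S) :
    ∀ᵐ ω ∂q.jumpChainLaw x, ¬ Summable fun n => (q.exitRate (ω n))⁻¹ := by
  set M : ℕ → (ℕ → S) → ℝ≥0∞ := fun n ω =>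
    (∏ k ∈ Finset.range n, ((q.exitRate (ω k) / (q.exitRate (ω k) + C) : ℝ≥0) : ℝ≥0∞)) *
      f (ω n) with hM
  have hMm : ∀ n, Measurable (M n) := fun n => by
    refine (Finset.measurable_fun_prod _ fun k _ => ?_).mul ?_
    · exact (measurable_of_countable
        fun y => ((q.exitRate y / (q.exitRate y + C) : ℝ≥0) : ℝ≥0∞)).comp (measurable_pi_apply k)
    · exact (measurable_of_countable fun y => (f y : ℝ≥0∞)).comp (measurable_pi_apply n)
  have hlim : ∫⁻ ω, liminf (fun n => M n ω) atTop ∂q.jumpChainLaw x ≤ f x := by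
    refine (lintegral_liminf_le hMm).trans ?_
    refine (liminf_le_liminf (Eventually.of_forall fun n =>
      q.lintegral_discounted_le hf x n)).trans ?_
    rw [liminf_const]
  have hlt := ae_lt_top (Measurable.liminf hMm) (hlim.trans_lt ENNReal.coe_lt_top).ne
  filter_upwards [hlt] with ω hω hsum
  obtain ⟨R, hR1, hR2⟩ := ENNReal.lt_iff_exists_nnreal_btwn.1 hω
  have hfreq : ∃ᶠ n in atTop, M n ω < R := frequently_lt_of_liminf_lt (by isBoundedDefault) hR1
  have hsum' : Summable fun n => (C : ℝ) * ((q.exitRate (ω n))⁻¹ : ℝ≥0) :=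
    (NNReal.summable_coe.2 hsum).mul_left _
  set K : ℝ := ∑' n, (C : ℝ) * ((q.exitRate (ω n))⁻¹ : ℝ≥0) with hK
  -- Each factor satisfies `q / (q + C) ≥ exp (-C / q)`, because `1 + C / q ≤ exp (C / q)`.
  have hlow : ∀ n, Real.exp (-K) ≤
      ∏ k ∈ Finset.range n, ((q.exitRate (ω k) / (q.exitRate (ω k) + C) : ℝ≥0) : ℝ) := by
    intro n
    have h1 : Real.exp (-∑ k ∈ Finset.range n, (C : ℝ) * ((q.exitRate (ω k))⁻¹ : ℝ≥0)) ≤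
        ∏ k ∈ Finset.range n, ((q.exitRate (ω k) / (q.exitRate (ω k) + C) : ℝ≥0) : ℝ) := by
      rw [← Finset.sum_neg_distrib, Real.exp_sum]
      refine Finset.prod_le_prod (fun _ _ => (Real.exp_pos _).le) fun k _ => ?_
      have hq : (0 : ℝ) < q.exitRate (ω k) := by exact_mod_cast q.exitRate_pos (ω k)
      have hC : (0 : ℝ) ≤ C := C.2
      rw [Real.exp_neg, NNReal.coe_div, NNReal.coe_add, NNReal.coe_inv,
        inv_le_comm₀ (Real.exp_pos _) (by positivity)]
      refine le_trans (le_of_eq ?_) (Real.add_one_le_exp _)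
      field_simp
      ring
    refine le_trans (Real.exp_le_exp.2 (neg_le_neg ?_)) h1
    exact hsum'.sum_le_tsum _ fun k _ => mul_nonneg C.2 (NNReal.coe_nonneg _)
  have hfreq2 : ∃ᶠ n in atTop, f (ω n) ≤ R * (Real.exp K).toNNReal := by
    refine hfreq.mono fun n hn => ?_
    rw [hM] at hn
    dsimp only at hn
    rw [← ENNReal.ofNNReal_finsetProd, ← ENNReal.coe_mul, ENNReal.coe_lt_coe, ← NNReal.coe_lt_coe,
      NNReal.coe_mul, NNReal.coe_prod] at hn
    rw [← NNReal.coe_le_coe, NNReal.coe_mul, Real.coe_toNNReal _ (Real.exp_pos _).le]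
    have h2 := (mul_le_mul_of_nonneg_right (hlow n) (f (ω n)).2).trans hn.le
    rw [Real.exp_neg, inv_mul_le_iff₀ (Real.exp_pos _)] at h2
    rw [mul_comm]
    exact h2
  obtain ⟨B, hB⟩ := ((hfin (R * (Real.exp K).toNNReal)).image q.exitRate).bddAbove
  have hev : ∀ᶠ n in atTop, (q.exitRate (ω n))⁻¹ < (B + 1)⁻¹ :=
    (NNReal.tendsto_atTop_zero_of_summable hsum).eventually_lt_const (by positivity)
  obtain ⟨n, hn1, hn2⟩ := (hfreq2.and_eventually hev).exists
  have h3 : q.exitRate (ω n) ≤ B := hB ⟨ω n, hn1, rfl⟩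
  rw [inv_lt_inv₀ (q.exitRate_pos _) (by positivity)] at hn2
  exact absurd (hn2.trans_le h3) (not_lt.2 (le_add_of_nonneg_right zero_le_one))

/-- **Lyapunov criterion**: a chain is non-explosive if some function with finite sublevel sets
grows along it at most exponentially in the mean. -/
theorem isNonExplosive_of_lyapunov {f : S → ℝ≥0} {C : ℝ≥0}
    (hfin : ∀ R : ℝ≥0, {y | f y ≤ R}.Finite)
    (hf : ∀ y, ∑' z, (q.rate y z : ℝ≥0∞) * f z ≤ (q.exitRate y + C) * f y) :
    q.IsNonExplosive := by
  intro x
  have hmeas : Measurable q.explosionTime := by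
    refine Measurable.tsum fun n => ENNReal.measurable_ofReal.comp ?_
    have h1 : Measurable fun ω : (ℕ → S) × (ℕ → ℝ) => (q.exitRate (ω.1 n) : ℝ) :=
      (measurable_of_countable fun y => (q.exitRate y : ℝ)).comp
        ((measurable_pi_apply n).comp measurable_fst)
    exact ((measurable_pi_apply n).comp measurable_snd).div h1
  refine (Measure.ae_prod_iff_ae_ae (hmeas (measurableSet_singleton ∞))).2 ?_
  filter_upwards [q.not_summable_inv_exitRate hfin hf x] with y hy
  have hy' : ¬ Summable fun n => ((q.exitRate (y n))⁻¹ : ℝ) := by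
    intro h
    refine hy (NNReal.summable_coe.1 ?_)
    simpa only [NNReal.coe_inv] using h
  filter_upwards [tsum_clock_eq_top (fun n => inv_nonneg.2 (NNReal.coe_nonneg _)) hy'] with e he
  rw [← he]
  refine tsum_congr fun n => ?_
  rw [holdingTime, div_eq_inv_mul]

/-! ### A criterion for transience -/

theorem isTransient_of_visits
    (h : ∀ x, ∀ᵐ ω ∂q.jumpChainLaw x, ∀ᶠ n in atTop, ω n ≠ x) : q.IsTransient := by
  intro x
  have hae : ∀ᵐ ω ∂q.law x, ∀ᶠ n in atTop, ω.1 n ≠ x := Measure.quasiMeasurePreserving_fst.ae (h x)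
  filter_upwards [hae] with ω hω
  obtain ⟨N, hN⟩ := eventually_atTop.1 hω
  -- A visit during the `n`-th holding interval ends by the jump time `n + 1`; the sum is a crude
  -- upper bound for the maximum over `n < N`.
  refine ⟨∑ n ∈ Finset.range N, (q.jumpTime (n + 1) ω).toNNReal, ?_⟩
  rintro t ht
  rw [Set.mem_ofPred_eq, process] at ht
  split_ifs at ht with hex
  have hs := Nat.find_spec hex
  set n := Nat.find hex
  have hn : n < N := by
    by_contra hn
    exact hN n (not_lt.1 hn) (Option.some.inj ht)
  have h1 : t ≤ (q.jumpTime (n + 1) ω).toNNReal :=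
    NNReal.le_toNNReal_of_coe_le hs.2.le
  exact h1.trans (Finset.single_le_sum (f := fun n => (q.jumpTime (n + 1) ω).toNNReal)
    (fun _ _ => zero_le) (Finset.mem_range.2 hn))

/-- The expected number of visits to `x` before time `n` of the embedded chain started at `y`. -/
noncomputable def visits (x : S) (n : ℕ) (y : S) : ℝ≥0∞ :=
  ∑ k ∈ Finset.range n, (q.step^[k] (Set.indicator {x} 1)) y

/-- Borel–Cantelli: the visit probabilities have a finite sum. -/
theorem ae_eventually_ne_of_visits_le {x : S} {K : ℝ≥0∞} (hK : K ≠ ∞)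
    (h : ∀ n, q.visits x n x ≤ K) : ∀ᵐ ω ∂q.jumpChainLaw x, ∀ᶠ n in atTop, ω n ≠ x := by
  have h1 : ∑' n, q.jumpChainLaw x {ω | ω n = x} ≠ ∞ := by
    refine ne_top_of_le_ne_top hK ?_
    rw [ENNReal.tsum_eq_iSup_nat]
    refine iSup_le fun n => le_trans (le_of_eq ?_) (h n)
    refine Finset.sum_congr rfl fun k _ => ?_
    rw [← q.lintegral_jumpChainLaw_apply]
    have h2 : (fun ω : ℕ → S => (Set.indicator {x} 1 : S → ℝ≥0∞) (ω k)) =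
        Set.indicator {ω : ℕ → S | ω k = x} 1 := by
      ext ω
      by_cases hω : ω k = x <;> simp [hω]
    have hms : MeasurableSet {ω : ℕ → S | ω k = x} :=
      measurableSet_eq_fun (measurable_pi_apply k) measurable_const
    rw [h2, lintegral_indicator_one hms]
  have h3 := measure_setOfPred_frequently_eq_zero h1
  have h4 : ∀ᵐ ω ∂q.jumpChainLaw x, ¬ ∃ᶠ n in atTop, ω n = x := by
    rw [ae_iff]; simpa only [not_not] using h3
  filter_upwards [h4] with ω hω
  simpa [Filter.not_frequently] using hω

end

end JumpRates
end InteractingWalks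

/-! ### Truncated Green functions and the resistance criterion for transience. -/

namespace InteractingWalks

namespace JumpRates

variable {S : Type*} (q : JumpRates S)

theorem step_add (φ ψ : S → ℝ≥0∞) (y : S) : q.step (φ + ψ) y = q.step φ y + q.step ψ y := by
  simp only [step, Pi.add_apply, mul_add, ENNReal.tsum_add]

theorem step_le_one {φ : S → ℝ≥0∞} (h : ∀ y, φ y ≤ 1) (y : S) : q.step φ y ≤ 1 := by
  calc q.step φ y ≤ ∑' z, q.jumpPMF y z := ENNReal.tsum_le_tsum fun z => mul_le_of_le_one_right' (h z)
    _ = 1 := (q.jumpPMF y).tsum_coe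

theorem iterate_step_le_one (x : S) (n : ℕ) (y : S) :
    (q.step^[n] (Set.indicator {x} 1)) y ≤ 1 := by
  induction n generalizing y with
  | zero => exact Set.indicator_le_self' (by simp) y
  | succ n ih => rw [Function.iterate_succ_apply']; exact q.step_le_one ih y

theorem visits_ne_top (x : S) (n : ℕ) (y : S) : q.visits x n y ≠ ∞ :=
  ENNReal.sum_ne_top.2 fun k _ => ((q.iterate_step_le_one x k y).trans_lt ENNReal.one_lt_top).ne

theorem step_visits (x : S) (n : ℕ) (y : S) :
    Set.indicator {x} 1 y + q.step (q.visits x n) y = q.visits x (n + 1) y := by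
  have h : q.step (q.visits x n) y =
      ∑ k ∈ Finset.range n, (q.step^[k + 1] (Set.indicator {x} 1)) y := by
    induction n with
    | zero => simp [visits, step]
    | succ n ih =>
      rw [Finset.sum_range_succ, ← ih, Function.iterate_succ_apply', ← step_add]
      congr 1
      ext z
      simp [visits, Finset.sum_range_succ]
  rw [h, visits, Finset.sum_range_succ', add_comm]
  rfl

/-- The Green equation for the truncated sum, kept as an inequality: the right side has one extra
term. -/
theorem visits_le_step (x : S) (n : ℕ) (y : S) :
    q.visits x n y ≤ Set.indicator {x} 1 y + q.step (q.visits x n) y := by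
  rw [step_visits, visits, visits, Finset.sum_range_succ]
  exact le_self_add

theorem finite_support_step (hq : ∀ z, {y | q.rate y z ≠ 0}.Finite) {φ : S → ℝ≥0∞}
    (hφ : φ.support.Finite) : (q.step φ).support.Finite := by
  refine (hφ.biUnion fun z _ => hq z).subset fun y hy => ?_
  by_contra h
  refine hy (ENNReal.tsum_eq_zero.2 fun z => ?_)
  by_contra hz
  obtain ⟨h1, h2⟩ := mul_ne_zero_iff.1 hz
  refine h (Set.mem_biUnion (x := z) h2 ?_)
  rw [Set.mem_ofPred_eq]
  rintro h0
  rw [jumpPMF_apply, h0] at h1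
  simp at h1

/-- The reason for truncating: a function of finite support has a finite Dirichlet form, and an
injective path must leave its support. -/
theorem finite_support_visits (hq : ∀ z, {y | q.rate y z ≠ 0}.Finite) (x : S) (n : ℕ) :
    (q.visits x n).support.Finite := by
  have h : ∀ k, (q.step^[k] (Set.indicator {x} 1)).support.Finite := by
    intro k
    induction k with
    | zero => exact (Set.finite_singleton x).subset Set.support_indicator_subset
    | succ k ih => rw [Function.iterate_succ_apply']; exact q.finite_support_step hq ih
  refine ((Finset.range n).finite_toSet.biUnion fun k _ => h k).subset fun y hy => ?_
  by_contra hc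
  refine hy (Finset.sum_eq_zero fun k hk => ?_)
  by_contra h0
  exact hc (Set.mem_biUnion (x := k) hk h0)

/-- The energy of a function of finite support along a simple path is bounded by twice its
Dirichlet form. -/
theorem sum_energy_le {m : S → ℝ} (hm : ∀ x, 0 ≤ m x)
    (hrev : ∀ x y, m x * q.rate x y = m y * q.rate y x) {g : S → ℝ} (hg : ∀ y, 0 ≤ g y)
    {T : Finset S} {z : ℕ → S} (hz : Function.Injective z) {N : ℕ} (hzT : ∀ k ≤ N, z k ∈ T) :
    ∑ k ∈ Finset.range N, m (z k) * q.rate (z k) (z (k + 1)) * (g (z k) - g (z (k + 1))) ^ 2 ≤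
      2 * ∑ y ∈ T, m y * g y * (q.exitRate y * g y - ∑ w ∈ T, q.rate y w * g w) := by
  classical
  set D : ℝ := ∑ y ∈ T, ∑ w ∈ T, m y * q.rate y w * (g y - g w) ^ 2 with hD
  have hterm : ∀ y w, 0 ≤ m y * q.rate y w * (g y - g w) ^ 2 := fun y w =>
    mul_nonneg (mul_nonneg (hm y) (NNReal.coe_nonneg _)) (sq_nonneg _)
  have h1 : ∑ k ∈ Finset.range N,
      m (z k) * q.rate (z k) (z (k + 1)) * (g (z k) - g (z (k + 1))) ^ 2 ≤ D := by
    rw [hD, ← Finset.sum_product']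
    -- The path is simple, so each of its edges is counted at most once in `D`.
    have hinj : Set.InjOn (fun k => (z k, z (k + 1))) (Finset.range N : Set ℕ) :=
      fun a _ b _ h => hz (Prod.ext_iff.1 h).1
    rw [← Finset.sum_image (f := fun p : S × S => m p.1 * q.rate p.1 p.2 * (g p.1 - g p.2) ^ 2)
      hinj]
    refine Finset.sum_le_sum_of_subset_of_nonneg ?_ fun p _ _ => hterm p.1 p.2
    intro p hp
    obtain ⟨k, hk, rfl⟩ := Finset.mem_image.1 hp
    have hk := Finset.mem_range.1 hk
    exact Finset.mem_product.2 ⟨hzT k hk.le, hzT (k + 1) hk⟩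
  -- Discrete integration by parts: reversibility allows swapping `y` and `w`, and the two copies of
  -- the sum make up the square.
  have h2 : D = 2 * ∑ y ∈ T, ∑ w ∈ T, m y * q.rate y w * (g y * (g y - g w)) := by
    have hswap : ∑ y ∈ T, ∑ w ∈ T, m y * q.rate y w * (g y * (g y - g w)) =
        ∑ y ∈ T, ∑ w ∈ T, m y * q.rate y w * (g w * (g w - g y)) := by
      rw [Finset.sum_comm]
      exact Finset.sum_congr rfl fun y _ => Finset.sum_congr rfl fun w _ => by rw [hrev w y]
    rw [two_mul]
    nth_rewrite 2 [hswap]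
    rw [hD, ← Finset.sum_add_distrib]
    refine Finset.sum_congr rfl fun y _ => ?_
    rw [← Finset.sum_add_distrib]
    exact Finset.sum_congr rfl fun w _ => by ring
  refine h1.trans (h2.le.trans (mul_le_mul_of_nonneg_left ?_ zero_le_two))
  refine Finset.sum_le_sum fun y _ => ?_
  have h3 : ∑ w ∈ T, (q.rate y w : ℝ) ≤ q.exitRate y := by
    exact_mod_cast (q.summable y).sum_le_tsum T fun _ _ => zero_le
  calc ∑ w ∈ T, m y * q.rate y w * (g y * (g y - g w))
      = m y * g y * ((∑ w ∈ T, (q.rate y w : ℝ)) * g y - ∑ w ∈ T, q.rate y w * g w) := by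
        rw [Finset.sum_mul, ← Finset.sum_sub_distrib, Finset.mul_sum]
        exact Finset.sum_congr rfl fun w _ => by ring
    _ ≤ _ := mul_le_mul_of_nonneg_left
        (sub_le_sub_right (mul_le_mul_of_nonneg_right h3 (hg y)) _) (mul_nonneg (hm y) (hg y))

/-- With `g` the truncated Green function and `R` the resistance of the path, Cauchy–Schwarz gives
`g x ^ 2 ≤ R * energy`, while the Green inequality bounds the energy by `2 * m x * q x * g x`.
Dividing by `g x` leaves a bound independent of `n`. -/
theorem visits_le_of_path {m : S → ℝ} (hm : ∀ x, 0 ≤ m x)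
    (hrev : ∀ x y, m x * q.rate x y = m y * q.rate y x)
    (hq : ∀ z, {y | q.rate y z ≠ 0}.Finite) {z : ℕ → S} (hz : Function.Injective z)
    (hpos : ∀ k, 0 < m (z k) * q.rate (z k) (z (k + 1)))
    (hsum : Summable fun k => (m (z k) * q.rate (z k) (z (k + 1)))⁻¹) (n : ℕ) :
    q.visits (z 0) n (z 0) ≤ ENNReal.ofReal
      ((∑' k, (m (z k) * q.rate (z k) (z (k + 1)))⁻¹) * (2 * (m (z 0) * q.exitRate (z 0)))) := by
  classical
  set x := z 0 with hx
  set R := ∑' k, (m (z k) * q.rate (z k) (z (k + 1)))⁻¹ with hR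
  set g : S → ℝ := fun y => (q.visits x n y).toReal with hgdef
  have hg : ∀ y, 0 ≤ g y := fun y => ENNReal.toReal_nonneg
  have hfs := q.finite_support_visits hq x n
  obtain ⟨N, hN⟩ : ∃ N, q.visits x n (z N) = 0 := by
    by_contra! h
    exact Set.infinite_of_injective_forall_mem hz (s := (q.visits x n).support) h hfs
  set T : Finset S := hfs.toFinset ∪ (Finset.range (N + 1)).image z with hT
  have hzT : ∀ k ≤ N, z k ∈ T := fun k hk => Finset.mem_union_right _
    (Finset.mem_image_of_mem z (Finset.mem_range.2 (Nat.lt_succ_of_le hk)))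
  have hsupp : ∀ y, y ∉ T → q.visits x n y = 0 := fun y hy => by
    by_contra h
    exact hy (Finset.mem_union_left _ (hfs.mem_toFinset.2 h))
  -- `visits_le_step` multiplied by the exit rate; `T` contains the support, so the sum over `T` is
  -- the full one.
  have hsub : ∀ y, q.exitRate y * g y - ∑ w ∈ T, q.rate y w * g w ≤
      if y = x then (q.exitRate x : ℝ) else 0 := by
    intro y
    have h1 := mul_le_mul_right (q.visits_le_step x n y) (q.exitRate y : ℝ≥0∞)
    rw [mul_add, exitRate_mul_step, tsum_eq_sum (s := T)
      (fun w hw => by rw [hsupp w hw, mul_zero])] at h1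
    have h2 : (q.exitRate y : ℝ≥0∞) * Set.indicator {x} 1 y =
        ((if y = x then q.exitRate x else 0 : ℝ≥0) : ℝ≥0∞) := by
      by_cases h : y = x <;> simp [h]
    have hfin : ∑ w ∈ T, (q.rate y w : ℝ≥0∞) * q.visits x n w ≠ ∞ :=
      ENNReal.sum_ne_top.2 fun w _ => ENNReal.mul_ne_top ENNReal.coe_ne_top (q.visits_ne_top x n w)
    rw [h2] at h1
    have h3 := ENNReal.toReal_mono (ENNReal.add_ne_top.2 ⟨ENNReal.coe_ne_top, hfin⟩) h1
    rw [ENNReal.toReal_add ENNReal.coe_ne_top hfin, ENNReal.toReal_sum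
      (fun w _ => ENNReal.mul_ne_top ENNReal.coe_ne_top (q.visits_ne_top x n w))] at h3
    simp only [ENNReal.toReal_mul, ENNReal.coe_toReal] at h3
    rw [sub_le_iff_le_add]
    refine h3.trans (le_of_eq ?_)
    congr 1
    split_ifs <;> rfl
  have henergy := q.sum_energy_le hm hrev hg hz hzT
  have hdir : ∑ y ∈ T, m y * g y * (q.exitRate y * g y - ∑ w ∈ T, q.rate y w * g w) ≤
      m x * g x * q.exitRate x := by
    calc _ ≤ ∑ y ∈ T, m y * g y * (if y = x then (q.exitRate x : ℝ) else 0) :=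
          Finset.sum_le_sum fun y _ =>
            mul_le_mul_of_nonneg_left (hsub y) (mul_nonneg (hm y) (hg y))
      _ = m x * g x * q.exitRate x := by
          simp only [mul_ite, mul_zero]
          rw [Finset.sum_ite_eq', if_pos (hzT 0 N.zero_le)]
  have htel : g x = ∑ k ∈ Finset.range N, (g (z k) - g (z (k + 1))) := by
    have hgN : g (z N) = 0 := by simp [hgdef, hN]
    rw [Finset.sum_range_sub' (fun k => g (z k)), hgN, sub_zero]
  have hcs : g x ^ 2 ≤ (∑ k ∈ Finset.range N, (m (z k) * q.rate (z k) (z (k + 1)))⁻¹) *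
      ∑ k ∈ Finset.range N,
        m (z k) * q.rate (z k) (z (k + 1)) * (g (z k) - g (z (k + 1))) ^ 2 := by
    rw [htel]
    refine Finset.sum_sq_le_sum_mul_sum_of_sq_le_mul _ (fun k _ => (inv_pos.2 (hpos k)).le)
      (fun k _ => mul_nonneg (hpos k).le (sq_nonneg _)) fun k _ => ?_
    rw [inv_mul_cancel_left₀ (hpos k).ne']
  have hRN : ∑ k ∈ Finset.range N, (m (z k) * q.rate (z k) (z (k + 1)))⁻¹ ≤ R :=
    hsum.sum_le_tsum _ fun k _ => (inv_pos.2 (hpos k)).le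
  have hR0 : 0 ≤ R := tsum_nonneg fun k => (inv_pos.2 (hpos k)).le
  have hfinal : g x ^ 2 ≤ R * (2 * (m x * g x * q.exitRate x)) := by
    refine hcs.trans (mul_le_mul hRN (henergy.trans (mul_le_mul_of_nonneg_left hdir zero_le_two))
      (Finset.sum_nonneg fun k _ => mul_nonneg (hpos k).le (sq_nonneg _)) hR0)
  have hle : g x ≤ R * (2 * (m x * q.exitRate x)) := by
    rcases (hg x).eq_or_lt with h0 | h0
    · rw [← h0]
      exact mul_nonneg hR0 (mul_nonneg zero_le_two (mul_nonneg (hm x) (NNReal.coe_nonneg _)))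
    · refine le_of_mul_le_mul_right (le_trans (le_of_eq (sq (g x)).symm) (hfinal.trans ?_)) h0
      exact le_of_eq (by ring)
  rw [← ENNReal.ofReal_toReal (q.visits_ne_top x n x)]
  exact ENNReal.ofReal_le_ofReal hle

/-- A reversible chain of finite range is transient if from every state there is a simple path of
finite total resistance. -/
theorem isTransient_of_path [Countable S] [MeasurableSpace S] [DiscreteMeasurableSpace S]
    {m : S → ℝ} (hm : ∀ x, 0 ≤ m x)
    (hrev : ∀ x y, m x * q.rate x y = m y * q.rate y x)
    (hq : ∀ z, {y | q.rate y z ≠ 0}.Finite)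
    (hpath : ∀ x, ∃ z : ℕ → S, z 0 = x ∧ Function.Injective z ∧
      (∀ k, 0 < m (z k) * q.rate (z k) (z (k + 1))) ∧
      Summable fun k => (m (z k) * q.rate (z k) (z (k + 1)))⁻¹) :
    q.IsTransient := by
  refine q.isTransient_of_visits fun x => ?_
  obtain ⟨z, rfl, hz, hpos, hsum⟩ := hpath x
  exact q.ae_eventually_ne_of_visits_le ENNReal.ofReal_ne_top
    fun n => q.visits_le_of_path hm hrev hq hz hpos hsum n

end JumpRates
end InteractingWalks

namespace InteractingWalks

/-! ### Greedy lattice paths -/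

/-- A lattice path of unit steps that stays close to the ray spanned by a probability vector. -/
theorem exists_path_near_ray {V : Type*} [Fintype V] [DecidableEq V] [Nonempty V] {v : V → ℝ}
    (hv : ∀ i, 0 ≤ v i) (hv1 : ∑ i, v i = 1) :
    ∃ z : ℕ → V → ℕ, z 0 = 0 ∧ (∀ k, ∃ i, z (k + 1) = z k + Pi.single i 1) ∧
      ∀ k j, |(z k j : ℝ) - k * v j| ≤ Fintype.card V := by
  -- Greedy rule: the next step raises the coordinate lagging most behind its target `(k + 1) * v
  -- j`.
  have hmax : ∀ (k : ℕ) (n : V → ℕ), ∃ i, ∀ j, (k + 1) * v j - n j ≤ (k + 1) * v i - (n i : ℝ) :=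
    fun k n => Finite.exists_max fun i => (k + 1) * v i - (n i : ℝ)
  choose c hc using hmax
  obtain ⟨z, hz0, hz⟩ : ∃ z : ℕ → V → ℕ, z 0 = 0 ∧
      ∀ k, z (k + 1) = z k + Pi.single (c k (z k)) 1 :=
    ⟨fun k => Nat.rec 0 (fun k n => n + Pi.single (c k n) 1) k, rfl, fun _ => rfl⟩
  have hsum : ∀ k, ∑ j, (z k j : ℝ) = k := by
    intro k
    induction k with
    | zero => simp [hz0]
    | succ k ih =>
      simp only [hz, Pi.add_apply, Nat.cast_add, Finset.sum_add_distrib, ih]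
      simp [Pi.single_apply]
  have hup : ∀ k j, (z k j : ℝ) ≤ k * v j + 1 := by
    intro k
    induction k with
    | zero => intro j; simp [hz0]
    | succ k ih =>
      intro j
      have h1 : (z k j : ℝ) ≤ (k + 1) * v j + 1 := by nlinarith [ih j, hv j]
      rw [hz, Pi.add_apply, Nat.cast_add, Nat.cast_add, Nat.cast_one]
      rcases eq_or_ne j (c k (z k)) with rfl | hj
      · rw [Pi.single_eq_same, Nat.cast_one, add_le_add_iff_right, ← sub_nonneg]
        by_contra! hneg
        -- The deficits sum to `(k + 1) - k = 1`, so the largest one cannot be negative.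
        have h2 : ∑ j, ((k + 1) * v j - (z k j : ℝ)) ≤ ∑ j : V, (0 : ℝ) :=
          Finset.sum_le_sum fun j _ => (hc k (z k) j).trans hneg.le
        rw [Finset.sum_sub_distrib, ← Finset.mul_sum, hv1, hsum, Finset.sum_const_zero] at h2
        linarith
      · rwa [Pi.single_eq_of_ne hj, Nat.cast_zero, add_zero]
  refine ⟨z, hz0, fun k => ⟨_, hz k⟩, fun k j => abs_le.2 ⟨?_, ?_⟩⟩
  -- By `hup` these terms are nonnegative; since they sum to `card V`, none exceeds it.
  · have h1 : ∑ l, (k * v l + 1 - (z k l : ℝ)) = Fintype.card V := by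
      rw [Finset.sum_sub_distrib, Finset.sum_add_distrib, ← Finset.mul_sum, hv1, hsum]
      simp
    have h2 := Finset.single_le_sum (f := fun l => k * v l + 1 - (z k l : ℝ))
      (fun l _ => sub_nonneg.2 (hup k l)) (Finset.mem_univ j)
    linarith
  · have h1 : (1 : ℝ) ≤ Fintype.card V := by exact_mod_cast Fintype.card_pos
    linarith [hup k j]

/-! ### The interaction matrix -/

variable {V : Type*} [Fintype V] [DecidableEq V] (G : SimpleGraph V) [DecidableRel G.Adj]

open Matrix

/-- The Rayleigh bound: `λ₁ I - A` has nonnegative spectrum because `eigenvalues₀` is sorted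
decreasingly. -/
theorem dotProduct_adjMatrix_mulVec_le [Nonempty V] (u : V → ℝ) :
    u ⬝ᵥ G.adjMatrix ℝ *ᵥ u ≤ lambdaOne G * (u ⬝ᵥ u) := by
  have hA := G.isHermitian_adjMatrix ℝ
  have hpsd : (algebraMap ℝ (Matrix V V ℝ) (lambdaOne G) - G.adjMatrix ℝ).PosSemidef := by
    rw [posSemidef_iff_isHermitian_and_spectrum_nonneg]
    refine ⟨IsHermitian.sub ?_ hA, ?_⟩
    · rw [algebraMap_eq_diagonal]
      exact isHermitian_diagonal _
    · intro r hr
      rw [← spectrum.singleton_sub_eq, hA.spectrum_real_eq_range_eigenvalues] at hr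
      obtain ⟨_, rfl, _, ⟨i, rfl⟩, rfl⟩ := hr
      exact sub_nonneg.2 (hA.eigenvalues₀_antitone (Fin.mk_le_of_le_val (Nat.zero_le _)))
  have h := hpsd.dotProduct_mulVec_nonneg u
  rw [star_trivial, sub_mulVec, dotProduct_sub, sub_nonneg, Algebra.algebraMap_eq_smul_one, smul_mulVec,
    one_mulVec, dotProduct_smul, smul_eq_mul] at h
  exact h

theorem exists_eigenvector_lambdaOne [Nonempty V] :
    ∃ u : V → ℝ, u ≠ 0 ∧ G.adjMatrix ℝ *ᵥ u = lambdaOne G • u := by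
  have hA := G.isHermitian_adjMatrix ℝ
  -- The vertex that indexes the largest eigenvalue in the reindexing used by `eigenvalues`.
  set j := (Fintype.equivOfCardEq (Fintype.card_fin (Fintype.card V))) ⟨0, Fintype.card_pos⟩
  refine ⟨hA.eigenvectorBasis j, ?_, ?_⟩
  · intro h
    exact hA.eigenvectorBasis.orthonormal.ne_zero j (by ext i; exact congrFun h i)
  · rw [hA.mulVec_eigenvectorBasis j]
    congr 1
    simp [IsHermitian.eigenvalues, lambdaOne, j]

theorem lambdaOne_nonneg [Nonempty V] : 0 ≤ lambdaOne G := by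
  obtain ⟨i⟩ := ‹Nonempty V›
  have h := dotProduct_adjMatrix_mulVec_le G (Pi.single i 1)
  simpa using h

/-- The matrix `α I + β A` of the interaction. -/
noncomputable def interaction (α β : ℝ) : Matrix V V ℝ := α • 1 + β • G.adjMatrix ℝ

variable {α β : ℝ}

theorem interaction_mulVec_apply (u : V → ℝ) (i : V) :
    (interaction G α β *ᵥ u) i = α * u i + β * ∑ j ∈ G.neighborFinset i, u j := by
  simp [interaction, add_mulVec, smul_mulVec]

theorem dotProduct_interaction_comm (u w : V → ℝ) :
    u ⬝ᵥ interaction G α β *ᵥ w = w ⬝ᵥ interaction G α β *ᵥ u := by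
  have h : (interaction G α β)ᵀ = interaction G α β := by simp [interaction]
  rw [dotProduct_mulVec, ← mulVec_transpose, h, dotProduct_comm]

theorem interaction_quad_add (u w : V → ℝ) :
    (u + w) ⬝ᵥ interaction G α β *ᵥ (u + w) = u ⬝ᵥ interaction G α β *ᵥ u +
      2 * (w ⬝ᵥ interaction G α β *ᵥ u) + w ⬝ᵥ interaction G α β *ᵥ w := by
  rw [mulVec_add, add_dotProduct, dotProduct_add, dotProduct_add,
    dotProduct_interaction_comm G u w]
  ring

theorem interaction_quad_single (i : V) :
    Pi.single i 1 ⬝ᵥ interaction G α β *ᵥ Pi.single i 1 = α := by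
  simp [interaction]

theorem pos_of_critical [Nonempty V] (hα : α < 0) (hαβ : α + β * lambdaOne G = 0) : 0 < β := by
  by_contra! h
  nlinarith [lambdaOne_nonneg G]

theorem interaction_quad (u : V → ℝ) :
    u ⬝ᵥ interaction G α β *ᵥ u = α * (u ⬝ᵥ u) + β * (u ⬝ᵥ G.adjMatrix ℝ *ᵥ u) := by
  rw [interaction, add_mulVec, smul_mulVec, smul_mulVec, one_mulVec, dotProduct_add,
    dotProduct_smul, dotProduct_smul, smul_eq_mul, smul_eq_mul]

theorem interaction_quad_nonpos [Nonempty V] (hα : α < 0) (hαβ : α + β * lambdaOne G = 0)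
    (u : V → ℝ) : u ⬝ᵥ interaction G α β *ᵥ u ≤ 0 := by
  rw [interaction_quad]
  have h := mul_le_mul_of_nonneg_left (dotProduct_adjMatrix_mulVec_le G u)
    (pos_of_critical G hα hαβ).le
  have h2 : β * (lambdaOne G * (u ⬝ᵥ u)) = -α * (u ⬝ᵥ u) := by
    rw [← mul_assoc]; congr 1; linarith
  linarith

/-- In the critical case the interaction matrix has a probability vector in its kernel. -/
theorem exists_probability_vector_interaction_mulVec_eq_zero [Nonempty V] (hα : α < 0)
    (hαβ : α + β * lambdaOne G = 0) :
    ∃ v : V → ℝ, (∀ i, 0 ≤ v i) ∧ ∑ i, v i = 1 ∧ interaction G α β *ᵥ v = 0 := by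
  obtain ⟨u, hu, hAu⟩ := exists_eigenvector_lambdaOne G
  have hβ := pos_of_critical G hα hαβ
  set w : V → ℝ := fun i => |u i| with hw
  have hww : w ⬝ᵥ w = u ⬝ᵥ u := Finset.sum_congr rfl fun i _ => abs_mul_abs_self (u i)
  -- The entries of `A` are nonnegative, so taking absolute values cannot lower the quadratic form.
  have hAw : u ⬝ᵥ G.adjMatrix ℝ *ᵥ u ≤ w ⬝ᵥ G.adjMatrix ℝ *ᵥ w := by
    refine Finset.sum_le_sum fun i _ => ?_
    rw [SimpleGraph.adjMatrix_mulVec_apply, SimpleGraph.adjMatrix_mulVec_apply]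
    refine (le_abs_self _).trans ?_
    rw [abs_mul]
    exact mul_le_mul_of_nonneg_left (Finset.abs_sum_le_sum_abs _ _) (abs_nonneg _)
  have hquad : w ⬝ᵥ interaction G α β *ᵥ w = 0 := by
    refine le_antisymm (interaction_quad_nonpos G hα hαβ w) ?_
    rw [interaction_quad, hww]
    rw [hAu, dotProduct_smul, smul_eq_mul] at hAw
    have h := mul_le_mul_of_nonneg_left hAw hβ.le
    have h2 : β * (lambdaOne G * (u ⬝ᵥ u)) = -α * (u ⬝ᵥ u) := by
      rw [← mul_assoc]; congr 1; linarith
    linarith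
  have hpsd : (-interaction G α β).PosSemidef := by
    refine PosSemidef.of_dotProduct_mulVec_nonneg ?_ fun x => ?_
    · have h : (interaction G α β)ᵀ = interaction G α β := by simp [interaction]
      rw [IsHermitian, conjTranspose_eq_transpose_of_trivial, transpose_neg, h]
    · rw [star_trivial, neg_mulVec, dotProduct_neg]
      exact neg_nonneg.2 (interaction_quad_nonpos G hα hαβ x)
  -- For a semidefinite matrix a zero of the quadratic form lies in the kernel; connectedness of `G`
  -- plays no role.
  have hker : interaction G α β *ᵥ w = 0 := by
    have h := (hpsd.dotProduct_mulVec_zero_iff w).1 (by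
      rw [star_trivial, neg_mulVec, dotProduct_neg, hquad, neg_zero])
    rwa [neg_mulVec, neg_eq_zero] at h
  have hpos : 0 < ∑ i, w i := by
    obtain ⟨i, hi⟩ := Function.ne_iff.1 hu
    exact Finset.sum_pos' (fun i _ => abs_nonneg _) ⟨i, Finset.mem_univ i, abs_pos.2 hi⟩
  refine ⟨(∑ i, w i)⁻¹ • w, fun i => mul_nonneg (inv_nonneg.2 hpos.le) (abs_nonneg _), ?_, ?_⟩
  · simp only [Pi.smul_apply, smul_eq_mul]
    rw [← Finset.mul_sum, inv_mul_cancel₀ hpos.ne']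
  · rw [mulVec_smul, hker, smul_zero]

/-- A continuous function is bounded below on a compact box; the box will hold the deviations from
the ray. -/
theorem exists_interaction_quad_ge (D : V → ℝ) :
    ∃ K : ℝ, ∀ r : V → ℝ, (∀ j, |r j| ≤ D j) → K ≤ r ⬝ᵥ interaction G α β *ᵥ r := by
  have hcont : Continuous fun r : V → ℝ => r ⬝ᵥ interaction G α β *ᵥ r := by fun_prop
  obtain ⟨K, hK⟩ := (isCompact_Icc (a := -D) (b := D)).bddBelow_image hcont.continuousOn
  exact ⟨K, fun r hr => hK ⟨r, ⟨fun j => (abs_le.1 (hr j)).1, fun j => (abs_le.1 (hr j)).2⟩, rfl⟩⟩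

end InteractingWalks

/-! ### The reversible measure of the walks, and the two conclusions. -/

namespace InteractingWalks

variable {V : Type*} [Fintype V] [DecidableEq V] (G : SimpleGraph V) [DecidableRel G.Adj]
variable {α β : ℝ}

open Matrix

theorem cast_add_single {V : Type*} [DecidableEq V] (ξ : V → ℕ) (i : V) :
    (fun j => (((ξ + Pi.single i 1 : V → ℕ) j : ℕ) : ℝ)) =
      (fun j => (ξ j : ℝ)) + Pi.single i 1 := by
  ext j
  rcases eq_or_ne j i with rfl | hj <;> simp [*]

theorem interaction_mulVec_single (i : V) :
    (interaction G α β *ᵥ Pi.single i 1) i = α := by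
  simp [interaction]

/-- The logarithm of the reversible measure of the system. -/
noncomputable def logWeight (α β : ℝ) (ξ : V → ℕ) : ℝ :=
  ((fun j => (ξ j : ℝ)) ⬝ᵥ interaction G α β *ᵥ fun j => (ξ j : ℝ)) / 2 - α / 2 * ∑ j, (ξ j : ℝ)

theorem interaction_quad_add_single (u : V → ℝ) (i : V) :
    (u + Pi.single i 1) ⬝ᵥ interaction G α β *ᵥ (u + Pi.single i 1) =
      u ⬝ᵥ interaction G α β *ᵥ u + 2 * (interaction G α β *ᵥ u) i + α := by
  rw [interaction_quad_add, interaction_quad_single, single_one_dotProduct]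

theorem sum_cast_add_single (ξ : V → ℕ) (i : V) :
    ∑ j, (((ξ + Pi.single i 1 : V → ℕ) j : ℕ) : ℝ) = ∑ j, (ξ j : ℝ) + 1 := by
  have h : ∑ j, (ξ + Pi.single i 1 : V → ℕ) j = ∑ j, ξ j + 1 := by
    simp [Finset.sum_add_distrib]
  exact_mod_cast h

/-- The linear term of `logWeight` cancels the diagonal contribution `α / 2`, leaving exactly the
logarithm of the birth rate: detailed balance against deaths of rate `1`. -/
theorem logWeight_add_single (ξ : V → ℕ) (i : V) :
    logWeight G α β (ξ + Pi.single i 1) =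
      logWeight G α β ξ + (interaction G α β *ᵥ fun j => (ξ j : ℝ)) i := by
  rw [logWeight, logWeight, sum_cast_add_single, cast_add_single, interaction_quad_add_single]
  ring

theorem coe_walkRate (ξ η : V → ℕ) :
    (walkRate G α β ξ η : ℝ) =
      (∑ i, if η = ξ + Pi.single i 1 then
        Real.exp ((interaction G α β *ᵥ fun j => (ξ j : ℝ)) i) else 0) +
      ∑ i, if η + Pi.single i 1 = ξ then 1 else 0 := by
  simp only [walkRate, NNReal.coe_add, NNReal.coe_sum, interaction_mulVec_apply]
  congr 1 <;> refine Finset.sum_congr rfl fun i _ => ?_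
  · split_ifs
    · rw [Real.coe_toNNReal _ (Real.exp_pos _).le]
    · rfl
  · split_ifs <;> rfl

theorem walkRate_add_single_ge (ξ : V → ℕ) (i : V) :
    Real.exp ((interaction G α β *ᵥ fun j => (ξ j : ℝ)) i) ≤
      walkRate G α β ξ (ξ + Pi.single i 1) := by
  rw [coe_walkRate]
  refine le_add_of_le_of_nonneg ?_ (Finset.sum_nonneg fun _ _ => by split_ifs <;> simp)
  refine le_trans (le_of_eq (if_pos rfl).symm) (Finset.single_le_sum
    (f := fun l => if ξ + Pi.single i 1 = ξ + Pi.single l 1 then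
        Real.exp ((interaction G α β *ᵥ fun j => (ξ j : ℝ)) l) else 0)
    (fun l _ => ?_) (Finset.mem_univ i))
  split_ifs
  · exact (Real.exp_pos _).le
  · exact le_rfl

/-- The conductance of an edge is the weight of its upper endpoint, an expression symmetric in the
two states. -/
theorem walkRate_reversible (ξ η : V → ℕ) :
    Real.exp (logWeight G α β ξ) * walkRate G α β ξ η =
      Real.exp (logWeight G α β η) * walkRate G α β η ξ := by
  have key : ∀ ξ η : V → ℕ, Real.exp (logWeight G α β ξ) * walkRate G α β ξ η =
      (∑ i, if η = ξ + Pi.single i 1 then Real.exp (logWeight G α β η) else 0) +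
        ∑ i, if ξ = η + Pi.single i 1 then Real.exp (logWeight G α β ξ) else 0 := by
    intro ξ η
    rw [coe_walkRate, mul_add, Finset.mul_sum, Finset.mul_sum]
    congr 1 <;> refine Finset.sum_congr rfl fun i _ => ?_
    · rw [mul_ite, mul_zero]
      split_ifs with h
      · rw [h, logWeight_add_single, Real.exp_add]
      · rfl
    · rw [mul_ite, mul_zero, mul_one]
      simp only [eq_comm]
  rw [key ξ η, key η ξ, add_comm]

theorem finite_walkRate_ne_zero (η : V → ℕ) : {ξ | walkRate G α β ξ η ≠ 0}.Finite := by
  have h : (⋃ i, ({ξ | ξ + Pi.single i 1 = η} ∪ {η + Pi.single i 1}) : Set (V → ℕ)).Finite := by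
    refine Set.finite_iUnion fun i => Set.Finite.union (Set.Subsingleton.finite ?_)
      (Set.finite_singleton _)
    intro a ha b hb
    exact add_right_cancel ((show a + Pi.single i 1 = η from ha).trans
      (show b + Pi.single i 1 = η from hb).symm)
  refine h.subset fun ξ hξ => ?_
  by_contra hc
  simp only [Set.mem_iUnion, Set.mem_union, not_exists, not_or] at hc
  refine hξ ?_
  rw [walkRate, Finset.sum_eq_zero fun i _ => if_neg fun h => (hc i).1 h.symm,
    Finset.sum_eq_zero fun i _ => if_neg fun h => (hc i).2 h.symm, add_zero]

/-! ### Transience -/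

theorem exists_path_logWeight_ge [Nonempty V] (hα : α < 0) (hαβ : α + β * lambdaOne G = 0)
    (x : V → ℕ) :
    ∃ (z : ℕ → V → ℕ) (K : ℝ), z 0 = x ∧ Function.Injective z ∧
      (∀ k, ∃ i, z (k + 1) = z k + Pi.single i 1) ∧
      ∀ k, K + -α / 2 * k ≤ logWeight G α β (z k) := by
  obtain ⟨v, hv, hv1, hker⟩ := exists_probability_vector_interaction_mulVec_eq_zero G hα hαβ
  obtain ⟨n, hn0, hstep, hclose⟩ := exists_path_near_ray hv hv1
  obtain ⟨K, hK⟩ := exists_interaction_quad_ge G (α := α) (β := β)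
    (fun j => (x j : ℝ) + Fintype.card V)
  have hstep' : ∀ k, ∃ i, x + n (k + 1) = x + n k + Pi.single i 1 := fun k => by
    obtain ⟨i, hi⟩ := hstep k
    exact ⟨i, by rw [hi, add_assoc]⟩
  have hsum : ∀ k, ∑ j, n k j = k := by
    intro k
    induction k with
    | zero => simp [hn0]
    | succ k ih =>
      obtain ⟨i, hi⟩ := hstep k
      simp [hi, Finset.sum_add_distrib, ih]
  refine ⟨fun k => x + n k, K / 2, by simp [hn0], ?_, hstep', fun k => ?_⟩
  · intro a b hab
    rw [← hsum a, ← hsum b, add_left_cancel hab]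
  · set r : V → ℝ := fun j => ((x + n k) j : ℝ) - k * v j with hr
    have hr1 : ∀ j, |r j| ≤ x j + Fintype.card V := fun j => by
      have h1 : r j = x j + ((n k j : ℝ) - k * v j) := by
        rw [hr]; simp only [Pi.add_apply, Nat.cast_add]; ring
      rw [h1]
      refine (abs_add_le _ _).trans (add_le_add ?_ (hclose k j))
      rw [Nat.abs_cast]
    have hdec : (fun j => ((x + n k) j : ℝ)) = (k : ℝ) • v + r := by
      ext j
      simp [hr]
    -- As `v` lies in the kernel, only the bounded deviation `r` contributes.
    have hquad : (fun j => ((x + n k) j : ℝ)) ⬝ᵥ interaction G α β *ᵥ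
        (fun j => ((x + n k) j : ℝ)) = r ⬝ᵥ interaction G α β *ᵥ r := by
      rw [hdec, interaction_quad_add, mulVec_smul, hker, smul_zero, dotProduct_zero,
        dotProduct_zero]
      ring
    have hS : (k : ℝ) ≤ ∑ j, ((x + n k) j : ℝ) := by
      have h2 : k ≤ ∑ j, (x + n k) j := by
        rw [← hsum k]
        exact Finset.sum_le_sum fun j _ => by simp [hsum k]
      exact_mod_cast h2
    rw [logWeight, hquad]
    have h3 := mul_le_mul_of_nonneg_left hS (show 0 ≤ -α / 2 by linarith)
    linarith [hK r hr1]

theorem walk_isTransient [Nonempty V] (hα : α < 0) (hαβ : α + β * lambdaOne G = 0) :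
    (walk G α β).IsTransient := by
  refine (walk G α β).isTransient_of_path (m := fun ξ => Real.exp (logWeight G α β ξ))
    (fun _ => (Real.exp_pos _).le) (walkRate_reversible G) (finite_walkRate_ne_zero G)
    fun x => ?_
  obtain ⟨z, K, hz0, hinj, hstep, hW⟩ := exists_path_logWeight_ge G hα hαβ x
  -- The weight of the upper endpoint `z (k + 1)` bounds the conductance from below, hence `k + 1`
  -- in the exponent.
  have hcond : ∀ k, Real.exp (K + -α / 2 * (k + 1 : ℕ)) ≤
      Real.exp (logWeight G α β (z k)) * walkRate G α β (z k) (z (k + 1)) := by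
    intro k
    obtain ⟨i, hi⟩ := hstep k
    refine (Real.exp_le_exp.2 (hW (k + 1))).trans ?_
    rw [hi, logWeight_add_single, Real.exp_add]
    exact mul_le_mul_of_nonneg_left (walkRate_add_single_ge G (z k) i) (Real.exp_pos _).le
  refine ⟨z, hz0, hinj, fun k => (Real.exp_pos _).trans_le (hcond k), ?_⟩
  have hgeo : Summable fun k : ℕ => Real.exp (-K + α / 2) * Real.exp (α / 2) ^ k :=
    (summable_geometric_of_lt_one (Real.exp_pos _).le
      (Real.exp_lt_one_iff.2 (by linarith))).mul_left _
  refine hgeo.of_nonneg_of_le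
    (fun k => inv_nonneg.2 (mul_nonneg (Real.exp_pos _).le (NNReal.coe_nonneg _))) fun k => ?_
  refine (inv_anti₀ (Real.exp_pos _) (hcond k)).trans (le_of_eq ?_)
  rw [← Real.exp_neg, ← Real.exp_nat_mul, ← Real.exp_add]
  congr 1
  push_cast
  ring

/-! ### Non-explosion -/

theorem tsum_walkRate_mul (ξ : V → ℕ) (F : (V → ℕ) → ℝ≥0∞) :
    ∑' η, (walkRate G α β ξ η : ℝ≥0∞) * F η =
      (∑ i, ((Real.exp ((interaction G α β *ᵥ fun j => (ξ j : ℝ)) i)).toNNReal : ℝ≥0∞) *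
        F (ξ + Pi.single i 1)) +
      ∑ i, if 0 < ξ i then F (ξ - Pi.single i 1) else 0 := by
  simp only [walkRate, ENNReal.coe_add, ENNReal.ofNNReal_finsetSum, add_mul, Finset.sum_mul]
  rw [ENNReal.tsum_add, Summable.tsum_finsetSum fun _ _ => ENNReal.summable,
    Summable.tsum_finsetSum fun _ _ => ENNReal.summable]
  congr 1 <;> refine Finset.sum_congr rfl fun i _ => ?_
  · rw [tsum_eq_single (ξ + Pi.single i 1), if_pos rfl, interaction_mulVec_apply]
    intro η hη
    rw [if_neg hη, ENNReal.coe_zero, zero_mul]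
  · split_ifs with hi
    · have hle : Pi.single i 1 ≤ ξ := by
        rw [Pi.le_def]
        intro j
        rcases eq_or_ne j i with rfl | hj
        · rw [Pi.single_eq_same]; exact hi
        · rw [Pi.single_eq_of_ne hj]; exact Nat.zero_le _
      rw [tsum_eq_single (ξ - Pi.single i 1), if_pos (tsub_add_cancel_of_le hle),
        ENNReal.coe_one, one_mul]
      intro η hη
      rw [if_neg, ENNReal.coe_zero, zero_mul]
      rintro rfl
      exact hη (add_tsub_cancel_right _ _).symm
    · refine ENNReal.tsum_eq_zero.2 fun η => ?_
      rw [if_neg, ENNReal.coe_zero, zero_mul]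
      rintro rfl
      simp at hi

/-- The Lyapunov function `1 + ∑ ξ_i - ½ ξᵀ (α I + β A) ξ`. -/
noncomputable def lyapunov (α β : ℝ) (ξ : V → ℕ) : ℝ :=
  1 + ∑ j, (ξ j : ℝ) - ((fun j => (ξ j : ℝ)) ⬝ᵥ interaction G α β *ᵥ fun j => (ξ j : ℝ)) / 2

theorem lyapunov_add_single (ξ : V → ℕ) (i : V) :
    lyapunov G α β (ξ + Pi.single i 1) =
      lyapunov G α β ξ + (1 - (interaction G α β *ᵥ fun j => (ξ j : ℝ)) i - α / 2) := by
  rw [lyapunov, lyapunov, sum_cast_add_single, cast_add_single, interaction_quad_add_single]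
  ring

/-- The first-order part changes sign compared with `lyapunov_add_single`; the second-order part `-α
/ 2` does not. -/
theorem lyapunov_sub_single {ξ : V → ℕ} {i : V} (hi : 0 < ξ i) :
    lyapunov G α β (ξ - Pi.single i 1) =
      lyapunov G α β ξ + ((interaction G α β *ᵥ fun j => (ξ j : ℝ)) i - 1 - α / 2) := by
  obtain ⟨η, rfl⟩ : ∃ η : V → ℕ, ξ = η + Pi.single i 1 := by
    refine ⟨ξ - Pi.single i 1, (tsub_add_cancel_of_le ?_).symm⟩
    rw [Pi.le_def]
    intro j
    rcases eq_or_ne j i with rfl | hj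
    · rw [Pi.single_eq_same]; exact hi
    · rw [Pi.single_eq_of_ne hj]; exact Nat.zero_le _
  rw [add_tsub_cancel_right, lyapunov_add_single, cast_add_single, mulVec_add, Pi.add_apply,
    interaction_mulVec_single]
  ring

theorem lyapunov_ge [Nonempty V] (hα : α < 0) (hαβ : α + β * lambdaOne G = 0) (ξ : V → ℕ) :
    1 + ∑ j, (ξ j : ℝ) ≤ lyapunov G α β ξ := by
  have h := interaction_quad_nonpos G hα hαβ fun j => (ξ j : ℝ)
  rw [lyapunov]
  linarith

/-- The death term is at most `exp b + a`. Absorbing `exp b` into the birth term gives `exp b * (2 +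
a - b)`, which `x + 1 ≤ exp x` at `x = 1 + a - b` bounds. -/
theorem drift_bound {a b d : ℝ} (ha : 0 ≤ a) (hd : 0 ≤ d) (hd1 : d ≤ 1) :
    Real.exp b * (1 - b + a) + d * (b - 1 + a) ≤ Real.exp (1 + a) + a := by
  have h1 : Real.exp b * (2 + a - b) ≤ Real.exp (1 + a) := by
    have h := mul_le_mul_of_nonneg_left (Real.add_one_le_exp (1 + a - b)) (Real.exp_pos b).le
    rw [← Real.exp_add, add_sub_cancel] at h
    linarith
  have h2 : d * (b - 1 + a) ≤ Real.exp b + a := by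
    have h3 := Real.add_one_le_exp b
    nlinarith [Real.exp_pos b, mul_le_mul_of_nonneg_left (show b - 1 + a ≤ Real.exp b + a by linarith) hd]
  linarith

theorem walk_isNonExplosive [Nonempty V] (hα : α < 0) (hαβ : α + β * lambdaOne G = 0) :
    (walk G α β).IsNonExplosive := by
  set a : ℝ := -α / 2 with ha
  have ha0 : 0 ≤ a := by rw [ha]; linarith
  set C : ℝ := Fintype.card V * (Real.exp (1 + a) + a) with hC
  have hC0 : 0 ≤ C := mul_nonneg (Nat.cast_nonneg _) (add_nonneg (Real.exp_pos _).le ha0)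
  have hge := lyapunov_ge G hα hαβ
  have hone : ∀ ξ, 1 ≤ lyapunov G α β ξ := fun ξ =>
    le_trans (le_add_of_nonneg_right (Finset.sum_nonneg fun _ _ => Nat.cast_nonneg _)) (hge ξ)
  have hnn : ∀ ξ, 0 ≤ lyapunov G α β ξ := fun ξ => zero_le_one.trans (hone ξ)
  refine (walk G α β).isNonExplosive_of_lyapunov (f := fun ξ => (lyapunov G α β ξ).toNNReal)
    (C := C.toNNReal) (fun R => ?_) fun ξ => ?_
  · refine (Set.finite_Iic (fun _ : V => ⌈(R : ℝ)⌉₊)).subset fun ξ hξ j => ?_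
    have h1 : lyapunov G α β ξ ≤ R := Real.toNNReal_le_iff_le_coe.1 hξ
    have h2 : (ξ j : ℝ) ≤ ∑ j, (ξ j : ℝ) :=
      Finset.single_le_sum (f := fun j => (ξ j : ℝ)) (fun _ _ => Nat.cast_nonneg _)
        (Finset.mem_univ j)
    have h3 : (ξ j : ℝ) ≤ ⌈(R : ℝ)⌉₊ := by linarith [hge ξ, Nat.le_ceil (R : ℝ)]
    exact_mod_cast h3
  · rw [JumpRates.coe_exitRate]
    have hq := tsum_walkRate_mul G (α := α) (β := β) ξ fun _ => 1
    simp only [mul_one] at hq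
    refine (tsum_walkRate_mul G ξ _).le.trans (le_trans ?_
      (mul_le_mul_left (add_le_add_left hq.ge _) _))
    set b : V → ℝ := interaction G α β *ᵥ fun j => (ξ j : ℝ) with hb
    set d : V → ℝ≥0 := fun i => if 0 < ξ i then 1 else 0 with hd
    have hd1 : ∀ i, (if 0 < ξ i then (1 : ℝ≥0∞) else 0) = (d i : ℝ≥0∞) := fun i => by
      rw [hd]; dsimp only; split_ifs <;> rfl
    have hd2 : ∀ i, (if 0 < ξ i then
        (((lyapunov G α β (ξ - Pi.single i 1)).toNNReal : ℝ≥0) : ℝ≥0∞) else 0) =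
        ((d i * (lyapunov G α β ξ + (b i - 1 + a)).toNNReal : ℝ≥0) : ℝ≥0∞) := fun i => by
      rw [hd]
      dsimp only
      split_ifs with hi
      · rw [lyapunov_sub_single G hi, one_mul, ha, neg_div, ← sub_eq_add_neg]
      · rw [zero_mul]; rfl
    simp only [hd1, hd2]
    simp only [← ENNReal.coe_mul, ← ENNReal.ofNNReal_finsetSum, ← ENNReal.coe_add,
      ENNReal.coe_le_coe]
    rw [← NNReal.coe_le_coe]
    -- Truncation at `0` is harmless: when `d i = 1` the value is `lyapunov` at an actual state, and
    -- otherwise the factor is `0`.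
    have hdown : ∀ i, (d i : ℝ) * ((lyapunov G α β ξ + (b i - 1 + a)).toNNReal : ℝ≥0) =
        d i * (lyapunov G α β ξ + (b i - 1 + a)) := fun i => by
      rw [hd]
      dsimp only
      split_ifs with hi
      · rw [Real.coe_toNNReal]
        have h := hnn (ξ - Pi.single i 1)
        rwa [lyapunov_sub_single G hi, sub_eq_add_neg _ (α / 2), ← neg_div] at h
      · simp
    simp only [NNReal.coe_add, NNReal.coe_mul, NNReal.coe_sum, hdown,
      Real.coe_toNNReal _ (Real.exp_pos _).le, Real.coe_toNNReal _ (hnn _),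
      Real.coe_toNNReal _ hC0]
    simp only [lyapunov_add_single]
    have hbound : ∑ i, (Real.exp (b i) * (1 - b i + a) + d i * (b i - 1 + a)) ≤ C := by
      rw [hC, ← nsmul_eq_mul, ← Finset.card_univ]
      refine Finset.sum_le_card_nsmul _ _ _ fun i _ => drift_bound ha0 (NNReal.coe_nonneg _) ?_
      rw [hd]
      dsimp only
      split_ifs <;> simp
    have hexpand : (∑ i, Real.exp (b i) * (lyapunov G α β ξ + (1 - b i - α / 2))) +
        ∑ i, (d i : ℝ) * (lyapunov G α β ξ + (b i - 1 + a)) =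
        ((∑ i, Real.exp (b i)) + ∑ i, (d i : ℝ)) * lyapunov G α β ξ +
          ∑ i, (Real.exp (b i) * (1 - b i + a) + d i * (b i - 1 + a)) := by
      rw [add_mul, Finset.sum_mul, Finset.sum_mul, ← Finset.sum_add_distrib,
        ← Finset.sum_add_distrib, ← Finset.sum_add_distrib]
      refine Finset.sum_congr rfl fun i _ => ?_
      rw [ha]
      ring
    refine (le_of_eq hexpand).trans ?_
    rw [add_mul _ C]
    -- Since `lyapunov ≥ 1`, the additive drift bound `C` is at most `C * lyapunov`, the form the
    -- criterion asks for.
    have h := mul_le_mul_of_nonneg_left (hone ξ) hC0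
    linarith

end InteractingWalks

theorem mainTheorem4 {V : Type*} [Fintype V] [DecidableEq V] [Nonempty V]
    (G : SimpleGraph V) [DecidableRel G.Adj] (α β : ℝ)
    (hα : α < 0) (hαβ : α + β * InteractingWalks.lambdaOne G = 0) :
    (InteractingWalks.walk G α β).IsTransient ∧
      (InteractingWalks.walk G α β).IsNonExplosive :=
  ⟨InteractingWalks.walk_isTransient G hα hαβ, InteractingWalks.walk_isNonExplosive G hα hαβ⟩
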